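/- Let $\Gamma$ be the Coxeter graph of type $E_8$, with vertices $1,\dots,8$. Let $L$ be the $E_8$ root lattice, with simple roots $\alpha_1,\dots,\alpha_8$ as a basis and with the symmetric bilinear form $(\cdot,\cdot)$ given on this basis by the Cartan matrix of type $E_8$. Let $W=W(E_8)$ be its Weyl group, that is, the group generated by the reflections $x\mapsto x-(\alpha,x)\alpha$ in all roots $\alpha\in L$ (the vectors with $(\alpha,\alpha)=2$), and let $s_i\in W$ be the reflection in $\alpha_i$. A fixed-point sublattice of $L$ is a sublattice of the form $L^H=\{x\in L: hx=x \text{ for all } h\in H\}$ for a subgroup $H\subseteq W$. The group $W$ acts on the set of fixed-point sublattices by $(g,M)\mapsto gM$. For a fixed-point sublattice $M$, its stabilizer is $W_M=\{g\in W: gx=x\text{ for all }x\in M\}$, and its coinvariant lattice is $M^\perp=\{x\in L:(x,y)=0\text{ for all }y\in M\}$. For a set $J$ of vertices (possibly empty) let $\Gamma_J$ be the full (induced) subgraph of $\Gamma$ on $J$. The Coxeter group $W(\Gamma_J)$ is the abstract group with generators $\sigma_j$ ($j\in J$) and relations $(\sigma_i\sigma_j)^{m_{ij}}=1$, where $m_{ii}=1$,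 $m_{ij}=3$ if $i,j$ are adjacent, and $m_{ij}=2$ otherwise. The root lattice $Q(\Gamma_J)$ is the free abelian group with basis $(e_j)_{j\in J}$ and the symmetric bilinear form with $(e_i,e_i)=2$, $(e_i,e_j)=-1$ if $i,j$ are adjacent, and $(e_i,e_j)=0$ otherwise. **Theorem.** The group $W$ has exactly $41$ orbits on the set of fixed-point sublattices of $L$. There is a bijection from the set of these orbits onto the set of isomorphism types of full subgraphs of $\Gamma$ with the following property. If the orbit of a fixed-point sublattice $M$ corresponds to the isomorphism type of $\Gamma_J$, then there is $g\in W$ such that 1. $M=g\,L^{W_J}$, where $W_J=\langle s_j : j\in J\rangle$; 2. the stabilizer $W_M$ is the Coxeter group determined by $\Gamma_J$: there is a group isomorphism $W(\Gamma_J)\to W_M$ with $\sigma_j\mapsto g s_j g^{-1}$ for all $j\in J$ (in particular $W_M=gW_Jg^{-1}$); 3. the coinvariant lattice $M^\perp$ is the root lattice determined by $\Gamma_J$: there is an isometry $Q(\Gamma_J)\to M^\perp$ with $e_j\mapsto g\alpha_j$ for all $j\in J$. -/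

import Mathlib

/-! The `E₈` root lattice, its Weyl group, fixed-point sublattices, and the Coxeter groups and root
lattices attached to full subgraphs of the `E₈` Coxeter graph. -/

namespace E8

/-! ### Simply laced graphs -/

/-- The root lattice of a graph with vertex set `V`, in coordinates with respect to the simple
roots, which are the standard basis vectors. Its bilinear form is `rootLatticeForm`. -/
abbrev RootLattice (V : Type*) : Type _ := V → ℤ

section Graph

variable {V : Type*} [DecidableEq V] (Γ : SimpleGraph V) [DecidableRel Γ.Adj]

/-- The Coxeter matrix of a graph without edge labels: `m(i,i) = 1`, `m(i,j) = 3` if `i` and `j`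
are joined by an edge, and `m(i,j) = 2` otherwise. -/
def coxeterMatrix : CoxeterMatrix V where
  M := Matrix.of fun i j => if i = j then 1 else if Γ.Adj i j then 3 else 2
  isSymm := by
    ext i j
    simp only [Matrix.transpose_apply, Matrix.of_apply, eq_comm (a := j) (b := i), Γ.adj_comm j i]
  diagonal i := by simp
  off_diagonal i j h := by
    simp only [Matrix.of_apply, if_neg h]
    split_ifs <;> decide

/-- The Gram matrix of the simple roots attached to the vertices of a graph: `2` on the diagonal,
`-1` for adjacent and `0` for distinct non-adjacent vertices. -/
def gramMatrix : Matrix V V ℤ :=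
  Matrix.of fun i j => if i = j then 2 else if Γ.Adj i j then -1 else 0

/-- The bilinear form of the root lattice of a graph. -/
noncomputable def rootLatticeForm [Fintype V] : LinearMap.BilinForm ℤ (RootLattice V) :=
  Matrix.toBilin' (gramMatrix Γ)

end Graph

/-! ### The Coxeter graph of type `E₈` and its full subgraphs -/

/-- The Coxeter graph of type `E₈`: two distinct vertices are joined when the corresponding
generators do not commute. All edges have the label `3`. -/
def coxeterGraph : SimpleGraph (Fin 8) where
  Adj i j := i ≠ j ∧ CoxeterMatrix.E₈ i j ≠ 2
  symm := ⟨fun i j h => ⟨h.1.symm, by rw [CoxeterMatrix.symmetric]; exact h.2⟩⟩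
  loopless := ⟨fun _ h => h.1 rfl⟩

instance : DecidableRel coxeterGraph.Adj := fun i j =>
  inferInstanceAs (Decidable (i ≠ j ∧ CoxeterMatrix.E₈ i j ≠ 2))

theorem coxeterMatrix_coxeterGraph : coxeterMatrix coxeterGraph = CoxeterMatrix.E₈ := by
  ext i j
  fin_cases i <;> fin_cases j <;> rfl

theorem gramMatrix_coxeterGraph : gramMatrix coxeterGraph = CartanMatrix.E₈ := by
  ext i j
  fin_cases i <;> fin_cases j <;> rfl

/-- The full (that is, induced) subgraph of the `E₈` Coxeter graph on a set of vertices. -/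
abbrev fullSubgraph (J : Finset (Fin 8)) : SimpleGraph (J : Set (Fin 8)) :=
  coxeterGraph.induce (J : Set (Fin 8))

/-- Two sets of vertices are equivalent when their full subgraphs are isomorphic graphs. -/
instance subgraphSetoid : Setoid (Finset (Fin 8)) where
  r J K := Nonempty (fullSubgraph J ≃g fullSubgraph K)
  iseqv := ⟨fun _ => ⟨RelIso.refl _⟩, fun ⟨f⟩ => ⟨f.symm⟩, fun ⟨f⟩ ⟨g⟩ => ⟨f.trans g⟩⟩

/-- The isomorphism types of full subgraphs of the `E₈` Coxeter graph. -/
abbrev SubgraphType : Type := Quotient subgraphSetoid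

/-! ### The `E₈` root lattice and its Weyl group -/

/-- The `E₈` root lattice, in coordinates with respect to the simple roots. -/
abbrev Lattice : Type := RootLattice (Fin 8)

/-- The bilinear form of the `E₈` root lattice; its Gram matrix is the Cartan matrix. -/
noncomputable def form : LinearMap.BilinForm ℤ Lattice := Matrix.toBilin' CartanMatrix.E₈

/-- The simple root at the vertex `i`. -/
def simpleRoot (i : Fin 8) : Lattice := Pi.single i 1

theorem form_simpleRoot (i j : Fin 8) :
    form (simpleRoot i) (simpleRoot j) = CartanMatrix.E₈ i j := by
  simp [form, simpleRoot]

theorem form_simpleRoot_self (i : Fin 8) : form (simpleRoot i) (simpleRoot i) = 2 := by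
  rw [form_simpleRoot, CartanMatrix.E₈_diag]

/-- The reflection `x ↦ x - (α, x) α` in a root `α`, that is, a vector of norm `2`. -/
noncomputable def reflection (α : Lattice) (h : form α α = 2) : Lattice ≃ₗ[ℤ] Lattice :=
  Module.reflection (x := α) (f := form α) h

theorem reflection_apply (α : Lattice) (h : form α α = 2) (x : Lattice) :
    reflection α h x = x - form α x • α :=
  Module.reflection_apply x h

/-- The Weyl group of type `E₈`: the group generated by the reflections in all roots. -/
noncomputable def weylGroup : Subgroup (Lattice ≃ₗ[ℤ] Lattice) :=
  Subgroup.closure {g | ∃ (α : Lattice) (h : form α α = 2), g = reflection α h}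

/-- The reflection in the simple root at the vertex `i`, as an element of the Weyl group. -/
noncomputable def simpleReflection (i : Fin 8) : weylGroup :=
  ⟨reflection (simpleRoot i) (form_simpleRoot_self i),
    Subgroup.subset_closure ⟨_, form_simpleRoot_self i, rfl⟩⟩

/-- The standard parabolic subgroup of the Weyl group attached to a set of vertices. -/
noncomputable def parabolic (J : Finset (Fin 8)) : Subgroup weylGroup :=
  Subgroup.closure (simpleReflection '' (J : Set (Fin 8)))

/-! ### Fixed-point sublattices -/

/-- The invariant lattice of a group of elements of the Weyl group. -/
noncomputable def fixedLattice (H : Subgroup weylGroup) : Submodule ℤ Lattice where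
  carrier := {x | ∀ h ∈ H, h • x = x}
  add_mem' hx hy h hh := by rw [smul_add, hx h hh, hy h hh]
  zero_mem' h _ := smul_zero h
  smul_mem' c x hx h hh := by rw [smul_comm, hx h hh]

theorem mem_fixedLattice {H : Subgroup weylGroup} {x : Lattice} :
    x ∈ fixedLattice H ↔ ∀ h ∈ H, h • x = x :=
  Iff.rfl

open scoped Pointwise in
theorem smul_fixedLattice (g : weylGroup) (H : Subgroup weylGroup) :
    g • fixedLattice H = fixedLattice (H.map (MulAut.conj g).toMonoidHom) := by
  ext x
  refine (Submodule.mem_smul_pointwise_iff_exists x g (fixedLattice H)).trans ?_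
  constructor
  · rintro ⟨y, hy, rfl⟩ k ⟨h, hh, rfl⟩
    have := hy h hh
    simp [MulAut.conj_apply, mul_smul, this]
  · intro hx
    refine ⟨g⁻¹ • x, fun h hh => ?_, smul_inv_smul g x⟩
    have := hx _ ⟨h, hh, rfl⟩
    simp only [MulEquiv.coe_toMonoidHom, MulAut.conj_apply, mul_smul] at this
    rw [eq_inv_smul_iff]
    exact this

open scoped Pointwise in
/-- The set of all fixed-point sublattices of the `E₈` root lattice, with the action of the Weyl
group that takes a sublattice `M` to its image `g M`. -/
noncomputable def fixedPointSublattices : SubMulAction weylGroup (Submodule ℤ Lattice) where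
  carrier := {M | ∃ H : Subgroup weylGroup, M = fixedLattice H}
  smul_mem' := by
    rintro g _ ⟨H, rfl⟩
    exact ⟨_, smul_fixedLattice g H⟩

/-- The set of orbits of fixed-point sublattices under the Weyl group. -/
abbrev Orbits : Type := MulAction.orbitRel.Quotient weylGroup fixedPointSublattices

/-- The orbit of a fixed-point sublattice. -/
noncomputable abbrev orbitOf (M : fixedPointSublattices) : Orbits := Quotient.mk _ M

/-- The stabilizer of a sublattice: all elements of the Weyl group that fix it pointwise. -/
noncomputable abbrev stabilizer (M : Submodule ℤ Lattice) : Subgroup weylGroup :=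
  fixingSubgroup weylGroup (M : Set Lattice)

/-- The coinvariant lattice: all lattice vectors orthogonal to the given invariant lattice. -/
noncomputable abbrev coinvariant (M : Submodule ℤ Lattice) : Submodule ℤ Lattice :=
  form.orthogonal M

end E8

open scoped Pointwise

/-!
The proof has a conceptual part, which describes all fixed-point sublattices through sets of
vertices, and a finite part, which compares sets of vertices.

*Every fixed-point sublattice is conjugate to some `L^{W_J}`.* Positive definiteness and evenness of
the form imply that the coefficients of a root all have the same sign
(`E8.nonneg_or_nonpos_of_form_self`), and induction on the height shows that `W` is generated by the
simple reflections (`E8.parabolic_univ`). A sublattice `M` contains a vector that is orthogonal only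
to those roots that are orthogonal to `M` (`E8.exists_generic`), and some element of `W` makes this
vector dominant (`E8.exists_dominant`). Since the stabilizer of a dominant vector is generated by
the simple reflections that fix it (`E8.mem_parabolic_of_smul_eq`), a fixed-point sublattice `M` is
carried to `L^{W_J}`, where `J` consists of the simple roots orthogonal to the dominant vector
(`E8.exists_smul_fixedLattice_parabolic`).

*Stabilizer and coinvariant lattice.* The statement on stabilizers and the presentation of `W_J`
rest on the faithfulness of the geometric representation: in the abstract Coxeter group, if `w s` is
longer than `w`, then `w` maps the simple root of `s` to a positive root
(`E8.coxeterHom_smul_nonneg`). Because the form is unimodular, the fundamental weights lie in `L`;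
hence the coinvariant lattice of `L^{W_J}` is the span of the simple roots in `J`
(`E8.mem_coinvariant_fixedLattice_parabolic`).

*Sets of vertices.* If `g L^{W_J} = L^{W_K}`, then `g` can be modified by an element of `W_K` so
that it maps the simple roots of `J` bijectively to those of `K`, which gives an isomorphism of full
subgraphs (`E8.Conjugate.nonempty_iso`). Conversely, isomorphic subgraphs have the same numbers of
walks with at most three steps. Nineteen explicit elements of `W` move every set of vertices, in
several steps, to one of 41 normal forms, and the walk counts of the normal forms are distinct
(`E8.card_normalForms`). As conjugate sets have isomorphic subgraphs and hence the same walk counts,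
sets with the same walk counts have the same normal form and are conjugate
(`E8.conjugate_of_walkCounts_eq`). So conjugacy, isomorphism and equality of walk counts all agree,
and there are 41 classes.
-/

namespace E8

/-! ### The form, positivity and fundamental weights -/

theorem form_apply (x y : Lattice) :
    form x y = ∑ i, ∑ j, x i * CartanMatrix.E₈ i j * y j := by
  simp only [form, Matrix.toBilin'_apply]

theorem form_comm (x y : Lattice) : form x y = form y x := by
  rw [form_apply, form_apply, Finset.sum_comm]
  refine Finset.sum_congr rfl fun i _ => Finset.sum_congr rfl fun j _ => ?_
  rw [← congrFun (congrFun CartanMatrix.E₈_transpose i) j, Matrix.transpose_apply]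
  ring

theorem form_eq (x y : Lattice) :
    form x y = 2 * (x 0 * y 0 + x 1 * y 1 + x 2 * y 2 + x 3 * y 3 + x 4 * y 4 + x 5 * y 5 +
        x 6 * y 6 + x 7 * y 7) -
      (x 0 * y 2 + x 2 * y 0 + x 1 * y 3 + x 3 * y 1 + x 2 * y 3 + x 3 * y 2 + x 3 * y 4 +
        x 4 * y 3 + x 4 * y 5 + x 5 * y 4 + x 5 * y 6 + x 6 * y 5 + x 6 * y 7 + x 7 * y 6) := by
  rw [form_apply]
  simp [Fin.sum_univ_eight, CartanMatrix.E₈]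
  ring

/-- The form is positive definite. -/
theorem form_self_nonneg_and (x : Lattice) : 0 ≤ form x x ∧ (form x x = 0 → x = 0) := by
  -- Completing squares from the ends of the three arms towards the branch vertex `3`.
  have key : 60 * form x x = 30 * (2 * x 0 - x 2) ^ 2 + 10 * (3 * x 2 - 2 * x 3) ^ 2 +
      30 * (2 * x 1 - x 3) ^ 2 + 30 * (2 * x 7 - x 6) ^ 2 + 10 * (3 * x 6 - 2 * x 5) ^ 2 +
      5 * (4 * x 5 - 3 * x 4) ^ 2 + 3 * (5 * x 4 - 4 * x 3) ^ 2 + 2 * x 3 ^ 2 := by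
    rw [form_eq]; ring
  refine ⟨by linarith only [key, sq_nonneg (2 * x 0 - x 2), sq_nonneg (3 * x 2 - 2 * x 3),
    sq_nonneg (2 * x 1 - x 3), sq_nonneg (2 * x 7 - x 6), sq_nonneg (3 * x 6 - 2 * x 5),
    sq_nonneg (4 * x 5 - 3 * x 4), sq_nonneg (5 * x 4 - 4 * x 3), sq_nonneg (x 3)], fun h => ?_⟩
  rw [h] at key
  have aux : ∀ a : ℤ, a ^ 2 ≤ 0 → a = 0 := fun a ha => by
    simpa using le_antisymm ha (sq_nonneg a)
  have h0 := sq_nonneg (2 * x 0 - x 2)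
  have h1 := sq_nonneg (3 * x 2 - 2 * x 3)
  have h2 := sq_nonneg (2 * x 1 - x 3)
  have h3 := sq_nonneg (2 * x 7 - x 6)
  have h4 := sq_nonneg (3 * x 6 - 2 * x 5)
  have h5 := sq_nonneg (4 * x 5 - 3 * x 4)
  have h6 := sq_nonneg (5 * x 4 - 4 * x 3)
  have h7 := sq_nonneg (x 3)
  have e0 := aux _ (show (2 * x 0 - x 2) ^ 2 ≤ 0 by linarith)
  have e1 := aux _ (show (3 * x 2 - 2 * x 3) ^ 2 ≤ 0 by linarith)
  have e2 := aux _ (show (2 * x 1 - x 3) ^ 2 ≤ 0 by linarith)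
  have e3 := aux _ (show (2 * x 7 - x 6) ^ 2 ≤ 0 by linarith)
  have e4 := aux _ (show (3 * x 6 - 2 * x 5) ^ 2 ≤ 0 by linarith)
  have e5 := aux _ (show (4 * x 5 - 3 * x 4) ^ 2 ≤ 0 by linarith)
  have e6 := aux _ (show (5 * x 4 - 4 * x 3) ^ 2 ≤ 0 by linarith)
  have e7 := aux _ (show (x 3) ^ 2 ≤ 0 by linarith)
  ext i
  fin_cases i <;> simp <;> omega

theorem form_self_nonneg (x : Lattice) : 0 ≤ form x x := (form_self_nonneg_and x).1

theorem even_form_self (x : Lattice) : Even (form x x) := by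
  refine ⟨x 0 * x 0 + x 1 * x 1 + x 2 * x 2 + x 3 * x 3 + x 4 * x 4 + x 5 * x 5 + x 6 * x 6 +
    x 7 * x 7 - (x 0 * x 2 + x 1 * x 3 + x 2 * x 3 + x 3 * x 4 + x 4 * x 5 + x 5 * x 6 +
    x 6 * x 7), ?_⟩
  rw [form_eq]
  ring

theorem two_le_form_self {x : Lattice} (hx : x ≠ 0) : 2 ≤ form x x := by
  obtain ⟨k, hk⟩ := even_form_self x
  have h0 := form_self_nonneg x
  have h1 : form x x ≠ 0 := fun h => hx ((form_self_nonneg_and x).2 h)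
  omega

theorem form_sq_le (x y : Lattice) : form x y ^ 2 ≤ form x x * form y y :=
  LinearMap.BilinForm.apply_sq_le_of_symm form form_self_nonneg ⟨fun x y => form_comm x y⟩ x y

/-- The fundamental weights: the basis dual to the simple roots. They lie in the root lattice
because the form is unimodular; the table is the inverse of the Cartan matrix. -/
def fundamentalWeight : Fin 8 → Lattice :=
  ![![4, 5, 7, 10, 8, 6, 4, 2], ![5, 8, 10, 15, 12, 9, 6, 3], ![7, 10, 14, 20, 16, 12, 8, 4],
    ![10, 15, 20, 30, 24, 18, 12, 6], ![8, 12, 16, 24, 20, 15, 10, 5],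
    ![6, 9, 12, 18, 15, 12, 8, 4], ![4, 6, 8, 12, 10, 8, 6, 3], ![2, 3, 4, 6, 5, 4, 3, 2]]

theorem form_fundamentalWeight (i : Fin 8) (x : Lattice) : form (fundamentalWeight i) x = x i := by
  rw [form_eq]
  fin_cases i <;> simp [fundamentalWeight] <;> ring

/-- The Weyl vector, the sum of the fundamental weights. Pairing with it is the height, that is,
the sum of the coefficients with respect to the simple roots. -/
def weylVector : Lattice := ∑ i, fundamentalWeight i

theorem form_weylVector (x : Lattice) : form weylVector x = ∑ i, x i := by
  simp [weylVector, form_fundamentalWeight]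

theorem form_weylVector_pos {x : Lattice} (hx : 0 ≤ x) (h : x ≠ 0) : 0 < form weylVector x := by
  rw [form_weylVector]
  obtain ⟨i, hi⟩ := Function.ne_iff.1 h
  exact Finset.sum_pos' (fun i _ => hx i) ⟨i, Finset.mem_univ i, lt_of_le_of_ne (hx i) hi.symm⟩

theorem form_weylVector_simpleRoot (i : Fin 8) : form weylVector (simpleRoot i) = 1 := by
  simp [form_weylVector, simpleRoot]

theorem simpleRoot_ne_zero (i : Fin 8) : simpleRoot i ≠ 0 := fun h => by
  simpa [h] using form_weylVector_simpleRoot i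

theorem simpleRoot_nonneg (i : Fin 8) : 0 ≤ simpleRoot i := by
  simp [simpleRoot]

theorem simpleRoot_injective : Function.Injective simpleRoot := fun i j h => by
  by_contra hij
  simpa [simpleRoot, hij] using congrFun h i

theorem eq_sum_simpleRoot (x : Lattice) : x = ∑ i, x i • simpleRoot i := by
  conv_lhs => rw [← Finset.univ_sum_single x]
  refine Finset.sum_congr rfl fun i _ => ?_
  rw [simpleRoot, ← Pi.single_smul, smul_eq_mul, mul_one]

theorem form_eq_sum (x y : Lattice) : form x y = ∑ i, x i * form (simpleRoot i) y := by
  conv_lhs => rw [eq_sum_simpleRoot x]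
  simp only [map_sum, LinearMap.sum_apply, LinearMap.map_smul, LinearMap.smul_apply, smul_eq_mul]

theorem form_simpleRoot_of_adj {i j : Fin 8} (h : coxeterGraph.Adj i j) :
    form (simpleRoot i) (simpleRoot j) = -1 := by
  rw [form_simpleRoot, ← gramMatrix_coxeterGraph]
  simp [gramMatrix, h, h.ne]

theorem form_simpleRoot_of_not_adj {i j : Fin 8} (hij : i ≠ j) (h : ¬ coxeterGraph.Adj i j) :
    form (simpleRoot i) (simpleRoot j) = 0 := by
  rw [form_simpleRoot, ← gramMatrix_coxeterGraph]
  simp [gramMatrix, h, hij]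

theorem form_simpleRoot_nonpos {i j : Fin 8} (hij : i ≠ j) :
    form (simpleRoot i) (simpleRoot j) ≤ 0 := by
  by_cases h : coxeterGraph.Adj i j
  · simp [form_simpleRoot_of_adj h]
  · simp [form_simpleRoot_of_not_adj hij h]

/-! ### Roots -/

/-- The coefficients of a root with respect to the simple roots all have the same sign: the positive
and the negative part of a root have a nonpositive product, so if both were nonzero, the norm of the
root would be at least `2 + 2`. -/
theorem nonneg_or_nonpos_of_form_self {x : Lattice} (hx : form x x = 2) : 0 ≤ x ∨ x ≤ 0 := by
  by_contra! h
  have hp : x⁺ ≠ 0 := fun h0 => h.2 (posPart_eq_zero.1 h0)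
  have hn : x⁻ ≠ 0 := fun h0 => h.1 (negPart_eq_zero.1 h0)
  have hpn : form x⁺ x⁻ ≤ 0 := by
    rw [form_apply]
    refine Finset.sum_nonpos fun i _ => Finset.sum_nonpos fun j _ => ?_
    have h1 : 0 ≤ x⁺ i := posPart_nonneg x i
    have h2 : 0 ≤ x⁻ j := negPart_nonneg x j
    rcases eq_or_ne i j with rfl | hij
    · have h3 : x⁺ i * x⁻ i = 0 := by
        rw [Pi.posPart_apply, Pi.negPart_apply]
        rcases le_total 0 (x i) with h | h
        · simp [negPart_eq_zero.2 h]
        · simp [posPart_eq_zero.2 h]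
      rw [mul_right_comm, h3, zero_mul]
    · have h3 := form_simpleRoot_nonpos hij
      rw [form_simpleRoot] at h3
      nlinarith [mul_nonneg h1 h2]
  have h2p := two_le_form_self hp
  have h2n := two_le_form_self hn
  have : form x x = form x⁺ x⁺ - 2 * form x⁺ x⁻ + form x⁻ x⁻ := by
    conv_lhs => rw [← posPart_sub_negPart x]
    simp only [map_sub, LinearMap.sub_apply, form_comm x⁻ x⁺]
    ring
  omega

/-- There are only finitely many roots: their coordinates are products with the fundamental weights
and are bounded by the Cauchy-Schwarz inequality. -/
theorem finite_roots : {x : Lattice | form x x = 2}.Finite := by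
  refine (Set.finite_Icc (fun i => -(2 * form (fundamentalWeight i) (fundamentalWeight i)))
    (fun i => 2 * form (fundamentalWeight i) (fundamentalWeight i))).subset ?_
  intro x hx
  have hx : form x x = 2 := hx
  have key : ∀ i, |x i| ≤ 2 * form (fundamentalWeight i) (fundamentalWeight i) := fun i => by
    have h := form_sq_le (fundamentalWeight i) x
    rw [form_fundamentalWeight, hx, mul_comm, ← sq_abs] at h
    refine le_trans ?_ h
    rcases eq_or_ne (x i) 0 with h0 | h0
    · simp [h0]
    · nlinarith [Int.one_le_abs h0]
  exact ⟨fun i => (abs_le.1 (key i)).1, fun i => (abs_le.1 (key i)).2⟩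

/-! ### The Weyl group -/

theorem smul_def (g : weylGroup) (x : Lattice) : g • x = (g : Lattice ≃ₗ[ℤ] Lattice) x := rfl

theorem form_reflection (α : Lattice) (h : form α α = 2) (x y : Lattice) :
    form (reflection α h x) (reflection α h y) = form x y := by
  simp only [reflection_apply, map_sub, LinearMap.sub_apply, map_smul, LinearMap.smul_apply,
    smul_eq_mul, h, form_comm x α]
  ring

theorem form_smul_smul (g : weylGroup) (x y : Lattice) : form (g • x) (g • y) = form x y := by
  obtain ⟨g, hg⟩ := g
  simp only [smul_def]
  induction hg using Subgroup.closure_induction generalizing x y with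
  | mem g hg =>
    obtain ⟨α, h, rfl⟩ := hg
    exact form_reflection α h x y
  | one => rfl
  | mul a b _ _ ha hb =>
    simp only [LinearEquiv.mul_apply]
    rw [ha, hb]
  | inv a _ ha =>
    rw [← ha (a⁻¹ x) (a⁻¹ y)]
    simp only [← LinearEquiv.mul_apply, mul_inv_cancel]
    rfl

theorem form_smul_left (g : weylGroup) (x y : Lattice) : form (g • x) y = form x (g⁻¹ • y) := by
  rw [← form_smul_smul g x, smul_inv_smul]

theorem weylGroup_ext {g h : weylGroup} (H : ∀ x : Lattice, g • x = h • x) : g = h :=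
  Subtype.ext (LinearEquiv.ext H)

theorem simpleReflection_smul (i : Fin 8) (x : Lattice) :
    simpleReflection i • x = x - form (simpleRoot i) x • simpleRoot i :=
  reflection_apply _ (form_simpleRoot_self i) _

theorem simpleReflection_smul_simpleRoot_self (i : Fin 8) :
    simpleReflection i • simpleRoot i = -simpleRoot i := by
  rw [simpleReflection_smul, form_simpleRoot_self, two_smul]
  abel

theorem simpleReflection_smul_simpleRoot_of_adj {i j : Fin 8} (h : coxeterGraph.Adj i j) :
    simpleReflection i • simpleRoot j = simpleRoot i + simpleRoot j := by
  rw [simpleReflection_smul, form_simpleRoot_of_adj h, neg_one_smul]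
  abel

theorem simpleReflection_smul_simpleRoot_of_not_adj {i j : Fin 8} (hij : i ≠ j)
    (h : ¬ coxeterGraph.Adj i j) : simpleReflection i • simpleRoot j = simpleRoot j := by
  rw [simpleReflection_smul, form_simpleRoot_of_not_adj hij h, zero_smul, sub_zero]

theorem simpleReflection_smul_eq_self_iff {i : Fin 8} {x : Lattice} :
    simpleReflection i • x = x ↔ form (simpleRoot i) x = 0 := by
  rw [simpleReflection_smul, sub_eq_self, smul_eq_zero_iff_left (simpleRoot_ne_zero i)]

theorem simpleReflection_mul_self (i : Fin 8) : simpleReflection i * simpleReflection i = 1 :=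
  weylGroup_ext fun x => by
    rw [mul_smul, one_smul, simpleReflection_smul i x, smul_sub, smul_comm,
      simpleReflection_smul_simpleRoot_self, simpleReflection_smul]
    simp

theorem simpleReflection_mem_parabolic {J : Finset (Fin 8)} {j : Fin 8} (hj : j ∈ J) :
    simpleReflection j ∈ parabolic J :=
  Subgroup.subset_closure ⟨j, hj, rfl⟩

theorem reflection_smul (g : weylGroup) {α β : Lattice} (h : form α α = 2) (h' : form β β = 2)
    (hβ : β = g • α) :
    reflection β h' =
      (g : Lattice ≃ₗ[ℤ] Lattice) * reflection α h * (g : Lattice ≃ₗ[ℤ] Lattice)⁻¹ := by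
  subst hβ
  ext1 x
  have : (g : Lattice ≃ₗ[ℤ] Lattice)⁻¹ x = g⁻¹ • x := rfl
  rw [LinearEquiv.mul_apply, LinearEquiv.mul_apply, this, reflection_apply, reflection_apply,
    ← smul_def, smul_sub, smul_inv_smul, form_smul_left, smul_comm]

/-- A positive root is the image of a simple root under a product of simple reflections: as long
as it is not simple itself, some simple reflection decreases its height by one. -/
theorem exists_smul_simpleRoot {x : Lattice} (h : form x x = 2) (hx : 0 ≤ x) :
    ∃ g ∈ parabolic Finset.univ, ∃ i, x = g • simpleRoot i := by
  induction hn : (form weylVector x).toNat generalizing x with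
  | zero =>
    have := form_weylVector_pos hx (by rintro rfl; simp at h)
    omega
  | succ n ih =>
    obtain ⟨i, hi⟩ : ∃ i, 0 < x i * form (simpleRoot i) x := by
      by_contra! H
      have := form_eq_sum x x
      have := Finset.sum_nonpos fun i (_ : i ∈ Finset.univ) => H i
      omega
    have hxi : 0 < x i := lt_of_le_of_ne (hx i) fun h0 => by simp [← h0] at hi
    have hfi : 0 < form (simpleRoot i) x := (pos_iff_pos_of_mul_pos hi).1 hxi
    rcases eq_or_ne x (simpleRoot i) with rfl | hne
    · exact ⟨1, one_mem _, i, (one_smul _ _).symm⟩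
    have hf1 : form (simpleRoot i) x = 1 := by
      have h2 := two_le_form_self (sub_ne_zero.2 hne)
      simp only [map_sub, LinearMap.sub_apply, h, form_simpleRoot_self,
        form_comm x (simpleRoot i)] at h2
      omega
    have hs : simpleReflection i • x = x - simpleRoot i := by
      rw [simpleReflection_smul, hf1, one_smul]
    obtain ⟨g, hg, j, hj⟩ := ih (x := simpleReflection i • x) (by rw [form_smul_smul, h])
      (by
        rw [hs]
        intro k
        rcases eq_or_ne k i with rfl | hk
        · simp only [simpleRoot, Pi.sub_apply, Pi.single_eq_same, Pi.zero_apply]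
          omega
        · simpa [simpleRoot, hk] using hx k)
      (by rw [hs, map_sub, form_weylVector_simpleRoot]; omega)
    refine ⟨simpleReflection i * g,
      mul_mem (simpleReflection_mem_parabolic (Finset.mem_univ i)) hg, j, ?_⟩
    rw [mul_smul, ← hj, ← mul_smul, simpleReflection_mul_self, one_smul]

/-- The Weyl group is generated by the simple reflections. -/
theorem parabolic_univ : parabolic Finset.univ = ⊤ := by
  have key : weylGroup ≤ (parabolic Finset.univ).map weylGroup.subtype := by
    refine (Subgroup.closure_le _).2 ?_
    rintro _ ⟨α, h, rfl⟩
    obtain ⟨g, hg, i, rfl | hi⟩ : ∃ g ∈ parabolic Finset.univ, ∃ i,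
        α = g • simpleRoot i ∨ -α = g • simpleRoot i := by
      rcases nonneg_or_nonpos_of_form_self h with h0 | h0
      · obtain ⟨g, hg, i, hi⟩ := exists_smul_simpleRoot h h0
        exact ⟨g, hg, i, Or.inl hi⟩
      · obtain ⟨g, hg, i, hi⟩ := exists_smul_simpleRoot (x := -α) (by simpa using h)
          (by simpa using h0)
        exact ⟨g, hg, i, Or.inr hi⟩
    · exact ⟨g * simpleReflection i * g⁻¹, mul_mem (mul_mem hg (simpleReflection_mem_parabolic
        (Finset.mem_univ i))) (inv_mem hg), (reflection_smul g (form_simpleRoot_self i) h rfl).symm⟩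
    · have h' : form (-α) (-α) = 2 := by simpa using h
      have : reflection α h = reflection (-α) h' := by
        ext1 x
        simp [reflection_apply]
      rw [this]
      exact ⟨g * simpleReflection i * g⁻¹, mul_mem (mul_mem hg (simpleReflection_mem_parabolic
        (Finset.mem_univ i))) (inv_mem hg), (reflection_smul g (form_simpleRoot_self i) h' hi).symm⟩
  refine eq_top_iff.2 fun g _ => ?_
  obtain ⟨g', hg', h⟩ := key g.2
  rwa [← Subtype.ext h]

/-- Every vector can be moved by the parabolic subgroup of `J` to one that is dominant for `J`:
choose an element of its orbit of maximal height. -/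
theorem exists_dominant (J : Finset (Fin 8)) (x : Lattice) :
    ∃ g ∈ parabolic J, ∀ j ∈ J, 0 ≤ form (simpleRoot j) (g • x) := by
  obtain ⟨m, ⟨g, hg, rfl⟩, hm⟩ := Int.exists_greatest_of_bdd
    (P := fun m => ∃ g ∈ parabolic J, form weylVector (g • x) = m)
    ⟨form weylVector weylVector * form x x + 1, by
      rintro _ ⟨g, -, rfl⟩
      -- The heights in the orbit are bounded by the Cauchy-Schwarz inequality.
      have h := form_sq_le weylVector (g • x)
      rw [form_smul_smul] at h
      nlinarith [sq_nonneg (form weylVector (g • x) - 1)]⟩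
    ⟨_, 1, one_mem _, rfl⟩
  refine ⟨g, hg, fun j hj => ?_⟩
  have := hm _ ⟨simpleReflection j * g, mul_mem (simpleReflection_mem_parabolic hj) hg, rfl⟩
  rw [mul_smul, simpleReflection_smul, map_sub, LinearMap.map_smul,
    form_weylVector_simpleRoot, smul_eq_mul] at this
  omega

/-! ### Generic vectors -/

/-- A sublattice contains a vector which is orthogonal only to those roots that are orthogonal to
the whole sublattice. -/
theorem exists_generic (M : Submodule ℤ Lattice) :
    ∃ x ∈ M, ∀ α, form α α = 2 → form α x = 0 → ∀ y ∈ M, form α y = 0 := by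
  suffices H : ∀ S : Set Lattice, S.Finite →
      ∃ x ∈ M, ∀ α ∈ S, form α x = 0 → ∀ y ∈ M, form α y = 0 from H _ finite_roots
  intro S hS
  induction S, hS using Set.Finite.induction_on with
  | empty => exact ⟨0, M.zero_mem, by simp⟩
  | @insert α S _ hS ih =>
    obtain ⟨x, hx, H⟩ := ih
    by_cases hα : form α x = 0 → ∀ y ∈ M, form α y = 0
    · exact ⟨x, hx, Set.forall_mem_insert.2 ⟨hα, H⟩⟩
    push Not at hα
    obtain ⟨h0, y, hy, hαy⟩ := hα
    -- If `α` vanishes on `x` but not on `y`, then `y` plus a large multiple of `x` is generic.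
    obtain ⟨t, ht⟩ := (hS.image fun β => |form β y|).bddAbove
    refine ⟨y + (t + 1) • x, add_mem hy (M.smul_mem _ hx), Set.forall_mem_insert.2 ⟨fun h => ?_,
      fun β hβ h => H β hβ ?_⟩⟩
    · rw [map_add, LinearMap.map_smul, h0, smul_zero, add_zero] at h
      exact absurd h hαy
    · by_contra hne
      have h1 : |form β y| ≤ t := ht ⟨β, hβ, rfl⟩
      rw [map_add, LinearMap.map_smul, smul_eq_mul] at h
      have h2 : |form β y| = |t + 1| * |form β x| := by
        rw [← abs_mul, ← abs_neg, neg_eq_of_add_eq_zero_right h]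
      have h3 : t + 1 ≤ |t + 1| := le_abs_self _
      nlinarith [Int.one_le_abs hne, abs_nonneg (t + 1)]

/-! ### Coxeter groups of full subgraphs -/

/-- The Coxeter system of the full subgraph on `J`. -/
noncomputable abbrev subgraphSystem (J : Finset (Fin 8)) :
    CoxeterSystem (coxeterMatrix (fullSubgraph J)) (coxeterMatrix (fullSubgraph J)).Group :=
  (coxeterMatrix (fullSubgraph J)).toCoxeterSystem

theorem coxeterMatrix_of_adj {J : Finset (Fin 8)} {i j : (J : Set (Fin 8))}
    (h : coxeterGraph.Adj i j) : coxeterMatrix (fullSubgraph J) i j = 3 := by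
  have hij : i ≠ j := fun e => h.ne (congrArg _ e)
  have : (fullSubgraph J).Adj i j := h
  simp only [coxeterMatrix, Matrix.of_apply, if_neg hij, if_pos this]

theorem coxeterMatrix_of_not_adj {J : Finset (Fin 8)} {i j : (J : Set (Fin 8))} (hij : i ≠ j)
    (h : ¬ coxeterGraph.Adj i j) : coxeterMatrix (fullSubgraph J) i j = 2 := by
  have : ¬ (fullSubgraph J).Adj i j := h
  simp only [coxeterMatrix, Matrix.of_apply, if_neg hij, if_neg this]

theorem simpleReflection_commute {i j : Fin 8} (hij : i ≠ j) (h : ¬ coxeterGraph.Adj i j) :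
    simpleReflection i * simpleReflection j = simpleReflection j * simpleReflection i :=
  weylGroup_ext fun x => by
    simp only [mul_smul, simpleReflection_smul, map_sub, LinearMap.map_smul,
      form_simpleRoot_of_not_adj hij h, form_simpleRoot_of_not_adj hij.symm (fun h' => h h'.symm),
      smul_eq_mul, mul_zero, sub_zero]
    abel

theorem simpleReflection_braid {i j : Fin 8} (h : coxeterGraph.Adj i j) :
    simpleReflection i * simpleReflection j * simpleReflection i =
      simpleReflection j * simpleReflection i * simpleReflection j :=
  weylGroup_ext fun x => by
    simp only [mul_smul, simpleReflection_smul, map_sub, LinearMap.map_smul,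
      form_simpleRoot_of_adj h, form_simpleRoot_of_adj h.symm, form_simpleRoot_self, smul_eq_mul,
      sub_smul]
    module

theorem isLiftable_simpleReflection (J : Finset (Fin 8)) :
    (coxeterMatrix (fullSubgraph J)).IsLiftable fun j => simpleReflection j := by
  intro i j
  rcases eq_or_ne i j with rfl | hij
  · rw [CoxeterMatrix.diagonal, pow_one, simpleReflection_mul_self]
  by_cases h : coxeterGraph.Adj i j
  · rw [coxeterMatrix_of_adj h]
    calc (simpleReflection i * simpleReflection j) ^ 3
        = simpleReflection i * simpleReflection j * simpleReflection i *
            (simpleReflection j * simpleReflection i * simpleReflection j) := by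
          simp only [pow_succ, pow_zero, one_mul, mul_assoc]
      _ = simpleReflection i * simpleReflection j * (simpleReflection i *
            simpleReflection i) * simpleReflection j * simpleReflection i := by
          rw [← simpleReflection_braid h]; group
      _ = 1 := by
          rw [simpleReflection_mul_self, mul_one, mul_assoc (simpleReflection i),
            simpleReflection_mul_self, mul_one, simpleReflection_mul_self]
  · have hij' : (i : Fin 8) ≠ j := fun e => hij (Subtype.ext e)
    rw [coxeterMatrix_of_not_adj hij h, pow_two, ← mul_assoc,
      mul_assoc (simpleReflection i), ← simpleReflection_commute hij' h, ← mul_assoc,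
      simpleReflection_mul_self, one_mul, simpleReflection_mul_self]

/-- The homomorphism from the Coxeter group of the full subgraph on `J` to the Weyl group that
takes the generators to simple reflections. -/
noncomputable def coxeterHom (J : Finset (Fin 8)) :
    (coxeterMatrix (fullSubgraph J)).Group →* weylGroup :=
  (subgraphSystem J).lift ⟨_, isLiftable_simpleReflection J⟩

theorem coxeterHom_simple {J : Finset (Fin 8)} (j : (J : Set (Fin 8))) :
    coxeterHom J ((subgraphSystem J).simple j) = simpleReflection j :=
  (subgraphSystem J).lift_apply_simple (isLiftable_simpleReflection J) j

theorem range_coxeterHom (J : Finset (Fin 8)) : (coxeterHom J).range = parabolic J := by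
  rw [MonoidHom.range_eq_map, ← (subgraphSystem J).subgroup_closure_range_simple,
    MonoidHom.map_closure, ← Set.range_comp, parabolic, Set.image_eq_range]
  congr 2

/-- If `w s` is longer than `w`, then `w` maps the simple root of `s` to a positive root.

This goes by induction on the length of `w`, writing `w = v t` with `v` shorter than `w`. All bonds
are at most `3`, so only few positions of `s` and `t` have to be distinguished. -/
theorem coxeterHom_smul_nonneg {J : Finset (Fin 8)} (w : (coxeterMatrix (fullSubgraph J)).Group)
    (s : (J : Set (Fin 8))) (hs : ¬ (subgraphSystem J).IsRightDescent w s) :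
    0 ≤ coxeterHom J w • simpleRoot s := by
  induction hn : (subgraphSystem J).length w using Nat.strong_induction_on generalizing w s with
  | _ n ih =>
  subst hn
  set cs := subgraphSystem J
  rcases eq_or_ne w 1 with rfl | hw
  · rw [map_one, one_smul]
    exact simpleRoot_nonneg _
  obtain ⟨t, ht⟩ := cs.exists_rightDescent_of_ne_one hw
  have hts : t ≠ s := fun h => hs (h ▸ ht)
  have hts' : (t : Fin 8) ≠ s := fun h => hts (Subtype.ext h)
  obtain ⟨v, rfl⟩ : ∃ v, w = v * cs.simple t := ⟨w * cs.simple t, by simp⟩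
  rw [cs.isRightDescent_iff, cs.simple_mul_simple_cancel_right] at ht
  rw [cs.not_isRightDescent_iff] at hs
  have hvt : ¬ cs.IsRightDescent v t := by rw [cs.not_isRightDescent_iff]; omega
  have lb : ∀ (x : (coxeterMatrix (fullSubgraph J)).Group) (i : (J : Set (Fin 8))),
      cs.length (x * cs.simple i) ≤ cs.length x + 1 := fun x i => by
    rcases cs.length_mul_simple x i with h | h <;> omega
  by_cases h : coxeterGraph.Adj t s
  -- If `s` and `t` are adjacent, then `w αₛ = v αₛ + v αₜ`, and both summands are positive unless
  -- `v = u s` with `u` shorter than `v`; in that case `w αₛ = u αₜ`.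
  · by_cases hvs : cs.IsRightDescent v s
    · obtain ⟨u, rfl⟩ : ∃ u, v = u * cs.simple s := ⟨v * cs.simple s, by simp⟩
      rw [cs.isRightDescent_iff, cs.simple_mul_simple_cancel_right] at hvs
      have hut : ¬ cs.IsRightDescent u t := by
        rw [cs.isRightDescent_iff]
        intro hut
        have hb : cs.simple s * cs.simple t * cs.simple s =
            cs.simple t * cs.simple s * cs.simple t := by
          have h3 := cs.simple_mul_simple_pow s t
          rw [coxeterMatrix_of_adj h.symm] at h3
          have h4 : cs.simple s * cs.simple t * cs.simple s *
              (cs.simple t * cs.simple s * cs.simple t) = 1 := by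
            rw [← h3]; simp only [pow_succ, pow_zero, one_mul, mul_assoc]
          rw [eq_comm, ← inv_eq_of_mul_eq_one_right h4]
          simp [mul_assoc]
        have h1 := lb (u * cs.simple t * cs.simple s) t
        have h2 := lb (u * cs.simple t) s
        rw [mul_assoc, mul_assoc u, ← mul_assoc (cs.simple t), ← hb, ← mul_assoc, ← mul_assoc] at h1
        omega
      have := ih _ (by omega) u t hut rfl
      rw [map_mul, map_mul, coxeterHom_simple, coxeterHom_simple, mul_smul, mul_smul,
        simpleReflection_smul_simpleRoot_of_adj h, smul_add,
        simpleReflection_smul_simpleRoot_of_adj h.symm, simpleReflection_smul_simpleRoot_self]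
      simpa using this
    · have h1 := ih _ (by omega) v s hvs rfl
      have h2 := ih _ (by omega) v t hvt rfl
      rw [map_mul, coxeterHom_simple, mul_smul, simpleReflection_smul_simpleRoot_of_adj h, smul_add]
      exact add_nonneg h2 h1
  -- Otherwise `s` and `t` commute, and `w αₛ = v αₛ`.
  · have hvs : ¬ cs.IsRightDescent v s := by
      rw [cs.isRightDescent_iff]
      intro hvs
      have hc : cs.simple t * cs.simple s = cs.simple s * cs.simple t := by
        have h2 := cs.simple_mul_simple_pow t s
        rw [coxeterMatrix_of_not_adj hts h, pow_two] at h2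
        rw [eq_comm, ← inv_eq_of_mul_eq_one_right h2]
        simp
      have h1 := lb (v * cs.simple s) t
      rw [mul_assoc, ← hc, ← mul_assoc] at h1
      omega
    rw [map_mul, coxeterHom_simple, mul_smul,
      simpleReflection_smul_simpleRoot_of_not_adj hts' h]
    exact ih _ (by omega) v s hvs rfl

/-- A right descent of `w` is mapped by `w` to a negative root. -/
theorem coxeterHom_smul_nonpos {J : Finset (Fin 8)} (w : (coxeterMatrix (fullSubgraph J)).Group)
    (s : (J : Set (Fin 8))) (hs : (subgraphSystem J).IsRightDescent w s) :
    coxeterHom J w • simpleRoot s ≤ 0 := by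
  rw [(subgraphSystem J).isRightDescent_iff_not_isRightDescent_mul] at hs
  have h := coxeterHom_smul_nonneg _ s hs
  rw [map_mul, coxeterHom_simple, mul_smul, simpleReflection_smul_simpleRoot_self, smul_neg] at h
  exact neg_nonneg.1 h

theorem coxeterHom_injective (J : Finset (Fin 8)) : Function.Injective (coxeterHom J) := by
  rw [injective_iff_map_eq_one]
  intro w hw
  by_contra hne
  obtain ⟨s, hs⟩ := (subgraphSystem J).exists_rightDescent_of_ne_one hne
  have h := coxeterHom_smul_nonpos w s hs
  rw [hw, one_smul] at h
  exact simpleRoot_ne_zero _ (le_antisymm h (simpleRoot_nonneg _))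

/-- The Coxeter group of the full subgraph on `J` is the parabolic subgroup of `J`. -/
noncomputable def coxeterEquiv (J : Finset (Fin 8)) :
    (coxeterMatrix (fullSubgraph J)).Group ≃* parabolic J :=
  (MonoidHom.ofInjective (coxeterHom_injective J)).trans
    (MulEquiv.subgroupCongr (range_coxeterHom J))

theorem coxeterEquiv_simple {J : Finset (Fin 8)} (j : (J : Set (Fin 8))) :
    (coxeterEquiv J ((subgraphSystem J).simple j) : weylGroup) = simpleReflection j :=
  coxeterHom_simple j

/-! ### Stabilizers and coinvariant lattices -/

/-- The stabilizer of a dominant vector is generated by the simple reflections that fix it: if `g`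
fixes the dominant vector `x` and maps the simple root `α` to a negative root, then
`(α, x) = (g α, x) ≤ 0`, so `x` is orthogonal to `α`, and the last letter of a reduced word of `g`
can be split off. -/
theorem mem_parabolic_of_smul_eq {x : Lattice} (hx : ∀ i, 0 ≤ form (simpleRoot i) x)
    {g : weylGroup} (hg : g • x = x) :
    g ∈ parabolic (Finset.univ.filter fun i => form (simpleRoot i) x = 0) := by
  obtain ⟨w, rfl⟩ : g ∈ (coxeterHom Finset.univ).range := by
    rw [range_coxeterHom, parabolic_univ]; trivial
  induction hn : (subgraphSystem Finset.univ).length w using Nat.strong_induction_on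
    generalizing w with
  | _ n ih =>
  rcases eq_or_ne w 1 with rfl | hw
  · rw [map_one]
    exact one_mem _
  set cs := subgraphSystem Finset.univ
  obtain ⟨s, hs⟩ := cs.exists_rightDescent_of_ne_one hw
  have hneg := coxeterHom_smul_nonpos w s hs
  rw [cs.isRightDescent_iff] at hs
  have h0 : form (simpleRoot s) x = 0 := by
    refine le_antisymm ?_ (hx s)
    rw [← form_smul_smul (coxeterHom Finset.univ w), hg, form_eq_sum]
    exact Finset.sum_nonpos fun i _ => mul_nonpos_of_nonpos_of_nonneg (hneg i) (hx i)
  have hsx : simpleReflection (s : Fin 8) • x = x := simpleReflection_smul_eq_self_iff.2 h0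
  have h1 := ih _ (by omega) (w * cs.simple s)
    (by rw [map_mul, coxeterHom_simple, mul_smul, hsx, hg]) rfl
  have h2 := mul_mem h1 (simpleReflection_mem_parabolic (j := s) (by simpa using h0))
  rwa [← coxeterHom_simple s, ← map_mul, cs.simple_mul_simple_cancel_right] at h2

theorem mem_fixedLattice_parabolic {J : Finset (Fin 8)} {x : Lattice} :
    x ∈ fixedLattice (parabolic J) ↔ ∀ j ∈ J, form (simpleRoot j) x = 0 := by
  rw [mem_fixedLattice]
  constructor
  · intro h j hj
    exact simpleReflection_smul_eq_self_iff.1 (h _ (simpleReflection_mem_parabolic hj))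
  · intro h g hg
    have : parabolic J ≤ MulAction.stabilizer weylGroup x := by
      refine (Subgroup.closure_le _).2 ?_
      rintro _ ⟨j, hj, rfl⟩
      exact simpleReflection_smul_eq_self_iff.2 (h j hj)
    exact this hg

theorem fundamentalWeight_mem_fixedLattice {J : Finset (Fin 8)} {i : Fin 8} (hi : i ∉ J) :
    fundamentalWeight i ∈ fixedLattice (parabolic J) :=
  mem_fixedLattice_parabolic.2 fun j hj => by
    rw [form_comm, form_fundamentalWeight, simpleRoot, Pi.single_eq_of_ne]
    exact fun h => hi (h ▸ hj)

/-- The coinvariant lattice of `L^{W_J}` is spanned by the simple roots in `J`, since `L^{W_J}`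
contains the fundamental weights of the other vertices. -/
theorem mem_coinvariant_fixedLattice_parabolic {J : Finset (Fin 8)} {x : Lattice} :
    x ∈ coinvariant (fixedLattice (parabolic J)) ↔ ∀ i ∉ J, x i = 0 := by
  rw [LinearMap.BilinForm.mem_orthogonal_iff]
  constructor
  · intro h i hi
    rw [← form_fundamentalWeight i x]
    exact h _ (fundamentalWeight_mem_fixedLattice hi)
  · intro h y hy
    rw [form_comm, form_eq_sum]
    refine Finset.sum_eq_zero fun i _ => ?_
    by_cases hi : i ∈ J
    · rw [mem_fixedLattice_parabolic.1 hy i hi, mul_zero]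
    · rw [h i hi, zero_mul]

theorem stabilizer_fixedLattice_parabolic (J : Finset (Fin 8)) :
    stabilizer (fixedLattice (parabolic J)) = parabolic J := by
  refine le_antisymm (fun g hg => ?_) fun g hg => ?_
  -- This vector is dominant, and it is orthogonal to exactly those simple roots that belong to `J`.
  · set x := ∑ i ∈ Jᶜ, fundamentalWeight i
    have hx : x ∈ fixedLattice (parabolic J) :=
      sum_mem fun i hi => fundamentalWeight_mem_fixedLattice (Finset.mem_compl.1 hi)
    have hj : ∀ j, form (simpleRoot j) x = if j ∈ J then 0 else 1 := fun j => by
      rw [form_comm]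
      simp [x, form_fundamentalWeight, simpleRoot, Pi.single_apply, ite_not]
    have := mem_parabolic_of_smul_eq (x := x) (fun j => by rw [hj]; split_ifs <;> norm_num)
      ((mem_fixingSubgroup_iff _).1 hg x hx)
    simpa [hj] using this
  · exact (mem_fixingSubgroup_iff _).2 fun x hx => hx g hg

open scoped Pointwise in
/-- Every fixed-point sublattice is conjugate to the fixed lattice of a standard parabolic
subgroup: move a generic vector of the sublattice to a dominant one. -/
theorem exists_smul_fixedLattice_parabolic (H : Subgroup weylGroup) :
    ∃ (g : weylGroup) (J : Finset (Fin 8)), fixedLattice H = g • fixedLattice (parabolic J) := by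
  obtain ⟨x, hx, hgen⟩ := exists_generic (fixedLattice H)
  obtain ⟨g, -, hg⟩ := exists_dominant Finset.univ x
  set J := Finset.univ.filter fun i => form (simpleRoot i) (g • x) = 0
  refine ⟨g⁻¹, J, ?_⟩
  rw [← inv_smul_eq_iff, inv_inv]
  have hH := smul_fixedLattice g H
  refine le_antisymm (fun y hy => ?_) (fun y hy => ?_)
  · obtain ⟨z, hz, rfl⟩ := (Submodule.mem_smul_pointwise_iff_exists y g _).1 hy
    refine mem_fixedLattice_parabolic.2 fun j hj => ?_
    rw [form_comm, form_smul_left, form_comm]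
    have h0 := (Finset.mem_filter.1 hj).2
    rw [form_comm, form_smul_left, form_comm] at h0
    exact hgen _ (by rw [form_smul_smul, form_simpleRoot_self]) h0 z hz
  · rw [hH]
    rintro _ ⟨h, hh, rfl⟩
    refine hy _ (mem_parabolic_of_smul_eq (fun i => hg i (Finset.mem_univ i)) ?_)
    simp [MulAut.conj_apply, mul_smul, hx h hh]

open scoped Pointwise

/-! ### Conjugate sets of vertices have isomorphic full subgraphs -/

/-- Two sets of vertices are conjugate when the fixed lattices of their parabolic subgroups lie in
the same orbit of the Weyl group. -/
def Conjugate (J K : Finset (Fin 8)) : Prop :=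
  ∃ g : weylGroup, g • fixedLattice (parabolic J) = fixedLattice (parabolic K)

theorem Conjugate.refl (J : Finset (Fin 8)) : Conjugate J J := ⟨1, one_smul _ _⟩

theorem Conjugate.symm {J K : Finset (Fin 8)} : Conjugate J K → Conjugate K J := by
  rintro ⟨g, hg⟩
  exact ⟨g⁻¹, by rw [← hg, inv_smul_smul]⟩

theorem Conjugate.trans {J K L : Finset (Fin 8)} :
    Conjugate J K → Conjugate K L → Conjugate J L := by
  rintro ⟨g, hg⟩ ⟨h, hh⟩
  exact ⟨h * g, by rw [mul_smul, hg, hh]⟩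

theorem mem_smul_fixedLattice_parabolic {g : weylGroup} {J : Finset (Fin 8)} {x : Lattice} :
    x ∈ g • fixedLattice (parabolic J) ↔ ∀ j ∈ J, form (g • simpleRoot j) x = 0 := by
  refine (Submodule.mem_smul_pointwise_iff_exists x g _).trans ?_
  constructor
  · rintro ⟨y, hy, rfl⟩ j hj
    rw [form_smul_smul, mem_fixedLattice_parabolic.1 hy j hj]
  · intro h
    refine ⟨g⁻¹ • x, mem_fixedLattice_parabolic.2 fun j hj => ?_, smul_inv_smul g x⟩
    rw [← form_smul_left, h j hj]

theorem smul_mem_coinvariant (g : weylGroup) {M : Submodule ℤ Lattice} {x : Lattice}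
    (hx : x ∈ coinvariant M) : g • x ∈ coinvariant (g • M) := by
  rw [LinearMap.BilinForm.mem_orthogonal_iff] at hx ⊢
  intro y hy
  obtain ⟨z, hz, rfl⟩ := (Submodule.mem_smul_pointwise_iff_exists y g _).1 hy
  rw [form_smul_smul]
  exact hx z hz

theorem simpleRoot_mem_coinvariant {J : Finset (Fin 8)} {j : Fin 8} (hj : j ∈ J) :
    simpleRoot j ∈ coinvariant (fixedLattice (parabolic J)) :=
  mem_coinvariant_fixedLattice_parabolic.2 fun i hi => by
    rw [simpleRoot, Pi.single_eq_of_ne]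
    exact fun h => hi (h ▸ hj)

theorem eq_sum_smul (g : weylGroup) (x : Lattice) : g • x = ∑ i, x i • g • simpleRoot i := by
  conv_lhs => rw [eq_sum_simpleRoot x, Finset.smul_sum]
  exact Finset.sum_congr rfl fun i _ => smul_comm _ _ _

/-- If `g` carries the fixed lattice of `J` to that of `K` and if `g⁻¹` maps the simple roots of
`K` to positive roots, then `g` maps the simple roots of `J` to simple roots of `K`: the vector
`g αⱼ` is a combination of simple roots of `K` with coefficients of one sign, and its image `αⱼ`
under `g⁻¹` has height one. -/
theorem exists_smul_simpleRoot_eq {g : weylGroup} {J K : Finset (Fin 8)}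
    (hg : g • fixedLattice (parabolic J) = fixedLattice (parabolic K))
    (hpos : ∀ k ∈ K, 0 ≤ g⁻¹ • simpleRoot k) {j : Fin 8} (hj : j ∈ J) :
    ∃ k ∈ K, g • simpleRoot j = simpleRoot k := by
  have hxK : ∀ i ∉ K, (g • simpleRoot j) i = 0 := by
    have h := smul_mem_coinvariant g (simpleRoot_mem_coinvariant hj)
    rw [hg] at h
    exact mem_coinvariant_fixedLattice_parabolic.1 h
  have hsum := eq_sum_smul g⁻¹ (g • simpleRoot j)
  rw [inv_smul_smul] at hsum
  have hroot : form (g • simpleRoot j) (g • simpleRoot j) = 2 := by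
    rw [form_smul_smul, form_simpleRoot_self]
  generalize g • simpleRoot j = x at *
  have hx : 0 ≤ x := by
    refine (nonneg_or_nonpos_of_form_self hroot).resolve_right fun hx => ?_
    refine simpleRoot_ne_zero j (le_antisymm ?_ (simpleRoot_nonneg j))
    rw [hsum]
    refine Finset.sum_nonpos fun i _ => ?_
    by_cases hi : i ∈ K
    · exact smul_nonpos_of_nonpos_of_nonneg (hx i) (hpos i hi)
    · rw [hxK i hi, zero_smul]
  have hht : form weylVector x ≤ 1 := by
    rw [← form_weylVector_simpleRoot j, hsum, form_weylVector x, map_sum]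
    refine Finset.sum_le_sum fun i _ => ?_
    rw [LinearMap.map_smul, smul_eq_mul]
    by_cases hi : i ∈ K
    · have := form_weylVector_pos (hpos i hi)
        (fun h => simpleRoot_ne_zero i ((smul_eq_zero_iff_eq _).1 h))
      exact le_mul_of_one_le_right (hx i) this
    · rw [hxK i hi, zero_mul]
  have hx0 : x ≠ 0 := by
    rintro rfl
    simp at hroot
  obtain ⟨k, hk⟩ : ∃ k, x k ≠ 0 := Function.ne_iff.1 hx0
  refine ⟨k, by_contra fun h => hk (hxK k h), ?_⟩
  by_contra hne
  have h := form_weylVector_pos (x := x - simpleRoot k) (fun i => ?_) (sub_ne_zero.2 hne)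
  · rw [map_sub, form_weylVector_simpleRoot] at h
    omega
  · rcases eq_or_ne i k with rfl | hik
    · have : 0 ≤ x i := hx i
      simp only [simpleRoot, Pi.sub_apply, Pi.single_eq_same, Pi.zero_apply]
      omega
    · simpa [simpleRoot, hik] using hx i

theorem adj_iff_form {i j : Fin 8} :
    coxeterGraph.Adj i j ↔ form (simpleRoot i) (simpleRoot j) = -1 := by
  refine ⟨form_simpleRoot_of_adj, fun h => by_contra fun h' => ?_⟩
  rcases eq_or_ne i j with rfl | hij
  · simp [form_simpleRoot_self] at h
  · simp [form_simpleRoot_of_not_adj hij h'] at h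

/-- Conjugate sets of vertices have isomorphic full subgraphs. After multiplication by an element of
the parabolic subgroup of `K`, a conjugating element carries simple roots to simple roots. -/
theorem Conjugate.nonempty_iso {J K : Finset (Fin 8)} (h : Conjugate J K) :
    Nonempty (fullSubgraph J ≃g fullSubgraph K) := by
  obtain ⟨g₀, hg₀⟩ := h
  -- For `g = h g₀`, dominance of `g ρ` with respect to `K` means that `(ρ, g⁻¹ αₖ) ≥ 0`, so the
  -- roots `g⁻¹ αₖ` are positive.
  obtain ⟨h, hh, hdom⟩ := exists_dominant K (g₀ • weylVector)
  obtain ⟨g, rfl⟩ : ∃ g, g₀ = h⁻¹ * g := ⟨h * g₀, by group⟩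
  have hg : g • fixedLattice (parabolic J) = fixedLattice (parabolic K) := by
    rw [mul_smul, inv_smul_eq_iff] at hg₀
    rw [hg₀]
    refine le_antisymm (fun x hx => ?_) fun x hx => ?_
    · obtain ⟨y, hy, rfl⟩ := (Submodule.mem_smul_pointwise_iff_exists x h _).1 hx
      rwa [hy h hh]
    · exact (Submodule.mem_smul_pointwise_iff_exists x h _).2 ⟨x, hx, hx h hh⟩
  have hpos : ∀ k ∈ K, 0 ≤ g⁻¹ • simpleRoot k := fun k hk => by
    have hroot : form (g⁻¹ • simpleRoot k) (g⁻¹ • simpleRoot k) = 2 := by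
      rw [form_smul_smul, form_simpleRoot_self]
    refine (nonneg_or_nonpos_of_form_self hroot).resolve_right fun hneg => ?_
    have h1 := hdom k hk
    rw [mul_smul, smul_inv_smul, form_comm, form_smul_left] at h1
    have h2 := form_weylVector_pos (neg_nonneg.2 hneg)
      (neg_ne_zero.2 fun h => simpleRoot_ne_zero k ((smul_eq_zero_iff_eq _).1 h))
    rw [map_neg] at h2
    omega
  have hJ : ∀ j : (J : Set (Fin 8)), ∃ k : (K : Set (Fin 8)), g • simpleRoot j = simpleRoot k :=
    fun j => by
      obtain ⟨k, hk, h⟩ := exists_smul_simpleRoot_eq hg hpos j.2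
      exact ⟨⟨k, hk⟩, h⟩
  choose f hf using hJ
  have hK : ∀ k ∈ K, ∃ j ∈ J, g⁻¹ • simpleRoot k = simpleRoot j := fun k hk =>
    exists_smul_simpleRoot_eq (by rw [← hg, inv_smul_smul])
      (fun j hj => by rw [inv_inv, hf ⟨j, hj⟩]; exact simpleRoot_nonneg _) hk
  refine ⟨⟨Equiv.ofBijective f ⟨fun i j hij => ?_, fun k => ?_⟩, fun {i j} => ?_⟩⟩
  · have : g • simpleRoot i = g • simpleRoot j := by rw [hf, hf, hij]
    exact Subtype.ext (simpleRoot_injective (smul_left_cancel g this))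
  · obtain ⟨j, hj, h⟩ := hK k k.2
    refine ⟨⟨j, hj⟩, Subtype.ext (simpleRoot_injective ?_)⟩
    rw [← hf, ← h, smul_inv_smul]
  · change coxeterGraph.Adj (f i) (f j) ↔ coxeterGraph.Adj i j
    rw [adj_iff_form, adj_iff_form, ← hf, ← hf, form_smul_smul]

/-! ### Isomorphic full subgraphs come from conjugate sets of vertices -/

/-- The list of neighbours of a vertex in the `E₈` Coxeter graph. -/
def neighbors : Fin 8 → List (Fin 8) :=
  ![[2], [3], [0, 3], [1, 2, 4], [3, 5], [4, 6], [5, 7], [6]]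

theorem mem_neighbors : ∀ {i j : Fin 8}, j ∈ neighbors i ↔ coxeterGraph.Adj i j := by
  unfold neighbors
  decide +kernel

/-- The number of walks with `n` steps in the full subgraph on `J` that start at a vertex. -/
def walks (J : Finset (Fin 8)) : ℕ → Fin 8 → ℕ
  | 0, _ => 1
  | n + 1, i => ∑ j ∈ J, if j ∈ neighbors i then walks J n j else 0

/-- The total numbers of walks with `0`, `1`, `2` and `3` steps in the full subgraph on `J`. They
turn out to determine the isomorphism type of the subgraph. -/
def walkCounts (J : Finset (Fin 8)) : List ℕ := (List.range 4).map fun n => ∑ j ∈ J, walks J n j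

theorem sum_eq_sum_of_equiv {J K : Finset (Fin 8)} (f : (J : Set (Fin 8)) ≃ (K : Set (Fin 8)))
    {a b : Fin 8 → ℕ} (h : ∀ j : (J : Set (Fin 8)), a j = b (f j)) :
    ∑ j ∈ J, a j = ∑ k ∈ K, b k := by
  rw [← Finset.sum_coe_sort J, ← Finset.sum_coe_sort K]
  exact Fintype.sum_equiv f _ _ h

theorem walkCounts_eq_of_iso {J K : Finset (Fin 8)} (f : fullSubgraph J ≃g fullSubgraph K) :
    walkCounts J = walkCounts K := by
  have hw : ∀ n (j : (J : Set (Fin 8))), walks J n j = walks K n (f j) := by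
    intro n
    induction n with
    | zero => exact fun _ => rfl
    | succ n ih =>
      intro i
      refine sum_eq_sum_of_equiv f.toEquiv fun j => ?_
      have hadj : coxeterGraph.Adj (f i) (f j) ↔ coxeterGraph.Adj i j := f.map_adj_iff
      simp only [mem_neighbors]
      exact if_congr hadj.symm (ih j) rfl
  exact List.map_congr_left fun n _ => sum_eq_sum_of_equiv f.toEquiv (hw n)

/-- The reflection in a simple root, on lists of coordinates. Lists are used so that the kernel can
evaluate words in the simple reflections. -/
def reflectCoords (i : Fin 8) (x : List ℤ) : List ℤ :=
  x.set i (((neighbors i).map fun j : Fin 8 => x.getD j 0).sum - x.getD i 0)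

/-- The coordinates of a simple root as a list. -/
def rootCoords (i : Fin 8) : List ℤ := (List.replicate 8 (0 : ℤ)).set i 1

/-- The lattice vector with a given list of coordinates. -/
def ofCoords (x : List ℤ) : Lattice := fun k => x.getD k 0

theorem ofCoords_rootCoords (i : Fin 8) : ofCoords (rootCoords i) = simpleRoot i := by
  ext k
  fin_cases i <;> fin_cases k <;> rfl

theorem ofCoords_reflectCoords (i : Fin 8) {x : List ℤ} (hx : x.length = 8) :
    ofCoords (reflectCoords i x) = simpleReflection i • ofCoords x := by
  have key : form (simpleRoot i) (ofCoords x) =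
      2 * x.getD i 0 - ((neighbors i).map fun j : Fin 8 => x.getD j 0).sum := by
    rw [form_eq]
    fin_cases i <;> simp [simpleRoot, ofCoords, neighbors]
    ring
  ext k
  rw [simpleReflection_smul, key, reflectCoords]
  generalize ((neighbors i).map fun j : Fin 8 => x.getD j 0).sum = c
  rcases eq_or_ne i k with rfl | hik
  · simp [ofCoords, simpleRoot, hx]
    ring
  · have hik' : (i : ℕ) ≠ k := fun h => hik (Fin.ext h)
    simp [ofCoords, simpleRoot, hik.symm, List.getElem?_set_ne hik']

theorem length_foldr_reflectCoords (w : List (Fin 8)) (x : List ℤ) :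
    (w.foldr reflectCoords x).length = x.length := by
  induction w with
  | nil => rfl
  | cons i w ih => rw [List.foldr_cons, reflectCoords, List.length_set, ih]

theorem ofCoords_foldr_reflectCoords (w : List (Fin 8)) {x : List ℤ} (hx : x.length = 8) :
    ofCoords (w.foldr reflectCoords x) = (w.map simpleReflection).prod • ofCoords x := by
  induction w with
  | nil => simp
  | cons i w ih =>
    rw [List.foldr_cons, ofCoords_reflectCoords i (by rw [length_foldr_reflectCoords, hx]), ih,
      List.map_cons, List.prod_cons, mul_smul]

/-- Elements of the Weyl group, as words in the simple reflections, each together with the pairs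
`(i, j)` of vertices such that it maps the simple root at `i` to the simple root at `j`. Each
of them is the product of the longest elements of the parabolic subgroups of a connected full
subgraph and of that subgraph with one vertex removed. -/
def moves : List (List (Fin 8) × List (Fin 8 × Fin 8)) :=
  [([6, 7], [(0, 0), (1, 1), (2, 2), (3, 3), (4, 4), (6, 7)]),
   ([3, 4], [(0, 0), (3, 4), (6, 6), (7, 7)]),
   ([2, 0], [(1, 1), (2, 0), (4, 4), (5, 5), (6, 6), (7, 7)]),
   ([5, 6, 7], [(0, 0), (1, 1), (2, 2), (3, 3), (5, 6), (6, 7)]),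
   ([4, 5, 6, 7], [(0, 0), (1, 1), (2, 2), (4, 5), (5, 6), (6, 7)]),
   ([1, 3, 2, 0], [(1, 3), (2, 0), (3, 2), (5, 5), (6, 6), (7, 7)]),
   ([2, 3, 0, 2], [(0, 3), (3, 0), (5, 5), (6, 6), (7, 7)]),
   ([1, 3, 4, 5, 6, 7], [(0, 0), (1, 3), (3, 4), (4, 5), (5, 6), (6, 7)]),
   ([6, 7, 5, 6, 4, 5], [(0, 0), (1, 1), (2, 2), (4, 7), (6, 4), (7, 5)]),
   ([2, 3, 0, 2, 1, 3], [(0, 3), (1, 0), (2, 1), (5, 5), (6, 6), (7, 7)]),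
   ([0, 2, 3, 4, 5, 6, 7], [(0, 2), (2, 3), (3, 4), (4, 5), (5, 6), (6, 7)]),
   ([1, 3, 4, 2, 3, 0, 2, 1, 3, 4], [(0, 4), (1, 0), (2, 3), (3, 2), (6, 6), (7, 7)]),
   ([3, 4, 5, 6, 7, 1, 3, 4, 5, 6], [(0, 0), (1, 4), (3, 5), (4, 6), (5, 7), (7, 1)]),
   ([2, 3, 4, 5, 6, 7, 0, 2, 3, 4, 5, 6], [(0, 3), (2, 4), (3, 5), (4, 6), (5, 7), (7, 0)]),
   ([4, 5, 6, 7, 3, 4, 5, 6, 1, 3, 4, 5], [(0, 0), (1, 5), (3, 6), (4, 7), (6, 1), (7, 3)]),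
   ([3, 4, 5, 6, 7, 2, 3, 4, 5, 6, 0, 2, 3, 4, 5],
    [(0, 4), (2, 5), (3, 6), (4, 7), (6, 0), (7, 2)]),
   ([0, 2, 3, 4, 5, 1, 3, 4, 2, 3, 0, 2, 1, 3, 4, 5],
    [(0, 5), (1, 2), (2, 4), (3, 3), (4, 1), (7, 7)]),
   ([1, 3, 4, 5, 6, 7, 2, 3, 4, 5, 6, 1, 3, 4, 5, 2, 3, 4, 1, 3, 2],
    [(1, 7), (3, 6), (4, 5), (5, 4), (6, 3), (7, 2)]),
   ([2, 3, 4, 5, 1, 3, 4, 2, 3, 0, 2, 1, 3, 4, 5, 1, 3, 4, 2, 3, 0, 2, 1, 3, 4],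
    [(0, 1), (1, 5), (2, 3), (3, 4), (5, 0), (7, 7)])]

set_option maxRecDepth 10000 in
theorem foldr_reflectCoords_of_mem_moves :
    ∀ m ∈ moves, ∀ p ∈ m.2, m.1.foldr reflectCoords (rootCoords p.1) = rootCoords p.2 := by
  decide +kernel

/-- The image of a set of vertices under the partial map on vertices that is attached to a move. -/
def moveTarget (m : List (Fin 8) × List (Fin 8 × Fin 8)) (J : Finset (Fin 8)) : Finset (Fin 8) :=
  Finset.univ.filter fun k => ∃ p ∈ m.2, p.1 ∈ J ∧ p.2 = k

theorem conjugate_moveTarget {m : List (Fin 8) × List (Fin 8 × Fin 8)} (hm : m ∈ moves)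
    {J : Finset (Fin 8)} (hJ : ∀ j ∈ J, ∃ p ∈ m.2, p.1 = j) : Conjugate J (moveTarget m J) := by
  set g := (m.1.map simpleReflection).prod
  have hg : ∀ p ∈ m.2, g • simpleRoot p.1 = simpleRoot p.2 := fun p hp => by
    rw [← ofCoords_rootCoords, ← ofCoords_rootCoords, ← foldr_reflectCoords_of_mem_moves m hm p hp,
      ofCoords_foldr_reflectCoords _ (by simp [rootCoords])]
  refine ⟨g, ?_⟩
  ext x
  rw [mem_smul_fixedLattice_parabolic, mem_fixedLattice_parabolic]
  constructor
  · intro h k hk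
    obtain ⟨p, hp, hpJ, rfl⟩ := (Finset.mem_filter.1 hk).2
    rw [← hg p hp, h p.1 hpJ]
  · intro h j hj
    obtain ⟨p, hp, rfl⟩ := hJ j hj
    rw [hg p hp]
    exact h _ (Finset.mem_filter.2 ⟨Finset.mem_univ _, p, hp, hj, rfl⟩)

/-- The number whose binary digits indicate the elements of a set of vertices. The order of the
vertices is chosen such that every class of conjugate sets contains only one local minimum with
respect to `moves`. -/
def rank (J : Finset (Fin 8)) : ℕ := ∑ j ∈ J, ![16, 128, 64, 32, 8, 2, 4, 1] j

/-- The sets of vertices whose rank is not decreased by any move. -/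
def normalForms : Finset (Finset (Fin 8)) :=
  Finset.univ.filter fun J =>
    ∀ m ∈ moves, (∀ j ∈ J, ∃ p ∈ m.2, p.1 = j) → rank J ≤ rank (moveTarget m J)

theorem exists_conjugate_mem_normalForms (J : Finset (Fin 8)) :
    ∃ K ∈ normalForms, Conjugate J K := by
  induction hn : rank J using Nat.strong_induction_on generalizing J with
  | _ n ih =>
  by_cases hJ : J ∈ normalForms
  · exact ⟨J, hJ, Conjugate.refl J⟩
  · simp only [normalForms, Finset.mem_filter, Finset.mem_univ, true_and, not_forall,
      not_le] at hJ
    obtain ⟨m, hm, h, hlt⟩ := hJ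
    obtain ⟨K, hK, hc⟩ := ih _ (hn ▸ hlt) _ rfl
    exact ⟨K, hK, (conjugate_moveTarget hm h).trans hc⟩

set_option maxRecDepth 10000 in
theorem card_normalForms :
    normalForms.card = 41 ∧ (normalForms.image walkCounts).card = 41 := by
  decide +kernel

theorem walkCounts_injOn : Set.InjOn walkCounts normalForms :=
  Finset.card_image_iff.1 (card_normalForms.2.trans card_normalForms.1.symm)

theorem Conjugate.walkCounts_eq {J K : Finset (Fin 8)} (h : Conjugate J K) :
    walkCounts J = walkCounts K :=
  h.nonempty_iso.elim walkCounts_eq_of_iso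

theorem conjugate_of_walkCounts_eq {J K : Finset (Fin 8)} (h : walkCounts J = walkCounts K) :
    Conjugate J K := by
  obtain ⟨J', hJ', hJ⟩ := exists_conjugate_mem_normalForms J
  obtain ⟨K', hK', hK⟩ := exists_conjugate_mem_normalForms K
  have : J' = K' := walkCounts_injOn hJ' hK' (by rw [← hJ.walkCounts_eq, h, hK.walkCounts_eq])
  exact hJ.trans (this ▸ hK.symm)

theorem conjugate_iff {J K : Finset (Fin 8)} :
    Conjugate J K ↔ Nonempty (fullSubgraph J ≃g fullSubgraph K) :=
  ⟨Conjugate.nonempty_iso, fun ⟨f⟩ => conjugate_of_walkCounts_eq (walkCounts_eq_of_iso f)⟩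

theorem card_subgraphType : Nat.card SubgraphType = 41 := by
  let f : normalForms → SubgraphType := fun J => Quotient.mk _ J
  have hf : Function.Bijective f := by
    refine ⟨fun J K h => Subtype.ext (walkCounts_injOn J.2 K.2 ?_), fun q => ?_⟩
    · exact (conjugate_iff.2 (Quotient.exact h)).walkCounts_eq
    · induction q using Quotient.inductionOn with
      | _ J =>
      obtain ⟨K, hK, h⟩ := exists_conjugate_mem_normalForms J
      exact ⟨⟨K, hK⟩, Quotient.sound (conjugate_iff.1 h.symm)⟩
  rw [← Nat.card_eq_of_bijective f hf, Nat.card_eq_fintype_card, Fintype.card_coe,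
    card_normalForms.1]

/-! ### Orbits of fixed-point sublattices -/

/-- The orbit of the fixed lattice of the standard parabolic subgroup of `J`. -/
noncomputable def parabolicOrbit (J : Finset (Fin 8)) : Orbits :=
  orbitOf ⟨fixedLattice (parabolic J), _, rfl⟩

theorem orbitOf_eq_parabolicOrbit_iff {M : fixedPointSublattices} {J : Finset (Fin 8)} :
    orbitOf M = parabolicOrbit J ↔
      ∃ g : weylGroup, (M : Submodule ℤ Lattice) = g • fixedLattice (parabolic J) := by
  rw [parabolicOrbit, orbitOf, orbitOf, Quotient.eq, MulAction.orbitRel_apply]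
  constructor
  · rintro ⟨g, rfl⟩
    exact ⟨g, rfl⟩
  · rintro ⟨g, hg⟩
    exact ⟨g, Subtype.ext hg.symm⟩

theorem parabolicOrbit_eq_iff {J K : Finset (Fin 8)} :
    parabolicOrbit J = parabolicOrbit K ↔ Nonempty (fullSubgraph J ≃g fullSubgraph K) := by
  rw [← conjugate_iff]
  refine orbitOf_eq_parabolicOrbit_iff.trans ⟨fun ⟨g, hg⟩ => ?_, fun h => ?_⟩
  · exact Conjugate.symm ⟨g, hg.symm⟩
  · obtain ⟨g, hg⟩ := h.symm
    exact ⟨g, hg.symm⟩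

/-- The bijection from isomorphism types of full subgraphs to orbits of fixed-point sublattices
that takes the type of `J` to the orbit of the fixed lattice of the parabolic subgroup of `J`. -/
noncomputable def subgraphTypeEquivOrbits : SubgraphType ≃ Orbits :=
  Equiv.ofBijective (Quotient.lift parabolicOrbit fun _ _ h => parabolicOrbit_eq_iff.2 h) <| by
    constructor
    · intro p q
      induction p, q using Quotient.inductionOn₂ with
      | _ J K => exact fun h => Quotient.sound (parabolicOrbit_eq_iff.1 h)
    · intro q
      induction q using Quotient.inductionOn with
      | _ M =>
      obtain ⟨_, H, rfl⟩ := M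
      obtain ⟨g, J, h⟩ := exists_smul_fixedLattice_parabolic H
      exact ⟨Quotient.mk _ J, (orbitOf_eq_parabolicOrbit_iff.2 ⟨g, h⟩).symm⟩

/-- Extension by zero identifies the root lattice of the full subgraph on `J` with the coinvariant
lattice of the fixed lattice of the parabolic subgroup of `J`. -/
noncomputable def rootLatticeEquiv (J : Finset (Fin 8)) :
    RootLattice (J : Set (Fin 8)) ≃ₗ[ℤ] coinvariant (fixedLattice (parabolic J)) where
  toFun x := ⟨∑ j, x j • simpleRoot j,
    sum_mem fun j _ => Submodule.smul_mem _ _ (simpleRoot_mem_coinvariant j.2)⟩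
  map_add' x y := Subtype.ext (by simp [add_mul, Finset.sum_add_distrib])
  map_smul' c x := Subtype.ext (by simp [mul_assoc, Finset.mul_sum])
  invFun x j := (x : Lattice) j
  left_inv x := by
    ext k
    simp [simpleRoot, Pi.single_apply]
  right_inv x := Subtype.ext <| by
    conv_rhs => rw [eq_sum_simpleRoot (x : Lattice)]
    rw [← Finset.sum_subset (Finset.subset_univ J)]
    · exact Finset.sum_coe_sort J fun i => (x : Lattice) i • simpleRoot i
    · intro i _ hi
      rw [mem_coinvariant_fixedLattice_parabolic.1 x.2 i hi, zero_smul]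

theorem coe_rootLatticeEquiv {J : Finset (Fin 8)} (x : RootLattice (J : Set (Fin 8))) :
    (rootLatticeEquiv J x : Lattice) = ∑ j, x j • simpleRoot j := rfl

theorem rootLatticeEquiv_single {J : Finset (Fin 8)} (j : (J : Set (Fin 8))) :
    (rootLatticeEquiv J (Pi.single j 1) : Lattice) = simpleRoot j := by
  rw [coe_rootLatticeEquiv, Finset.sum_eq_single j (fun i _ hi => by simp [hi]) (by simp),
    Pi.single_eq_same, one_smul]

theorem form_rootLatticeEquiv {J : Finset (Fin 8)} (x y : RootLattice (J : Set (Fin 8))) :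
    form (rootLatticeEquiv J x) (rootLatticeEquiv J y) = rootLatticeForm (fullSubgraph J) x y := by
  have hgram : ∀ i j : (J : Set (Fin 8)),
      form (simpleRoot i) (simpleRoot j) = gramMatrix (fullSubgraph J) i j := fun i j => by
    rw [form_simpleRoot, ← gramMatrix_coxeterGraph]
    rcases eq_or_ne i j with rfl | hij
    · simp [gramMatrix]
    · have hij' : (i : Fin 8) ≠ j := fun h => hij (Subtype.ext h)
      simp only [gramMatrix, Matrix.of_apply, if_neg hij, if_neg hij']
      rfl
  rw [coe_rootLatticeEquiv, coe_rootLatticeEquiv, rootLatticeForm, Matrix.toBilin'_apply]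
  simp only [map_sum, LinearMap.sum_apply, LinearMap.map_smul, LinearMap.smul_apply, smul_eq_mul,
    hgram]
  rw [Finset.sum_comm]
  exact Finset.sum_congr rfl fun i _ => Finset.sum_congr rfl fun j _ => by ring

theorem coinvariant_smul (g : weylGroup) (M : Submodule ℤ Lattice) :
    coinvariant (g • M) = g • coinvariant M := by
  refine le_antisymm (fun x hx => ?_) fun x hx => ?_
  · have h := smul_mem_coinvariant g⁻¹ hx
    rw [inv_smul_smul] at h
    exact (Submodule.mem_smul_pointwise_iff_exists x g _).2 ⟨_, h, smul_inv_smul g x⟩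
  · obtain ⟨y, hy, rfl⟩ := (Submodule.mem_smul_pointwise_iff_exists x g _).1 hx
    exact smul_mem_coinvariant g hy

/-- An element of the Weyl group identifies a coinvariant lattice with the coinvariant lattice of
the image. -/
noncomputable def coinvariantEquiv (g : weylGroup) (M : Submodule ℤ Lattice) :
    coinvariant M ≃ₗ[ℤ] coinvariant (g • M) :=
  ((g : Lattice ≃ₗ[ℤ] Lattice).submoduleMap (coinvariant M)).trans
    (LinearEquiv.ofEq _ _ (coinvariant_smul g M).symm)

theorem coe_coinvariantEquiv (g : weylGroup) {M : Submodule ℤ Lattice} (x : coinvariant M) :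
    (coinvariantEquiv g M x : Lattice) = g • (x : Lattice) := rfl

theorem stabilizer_smul (g : weylGroup) (M : Submodule ℤ Lattice) :
    stabilizer (g • M) = (stabilizer M).map (MulAut.conj g).toMonoidHom := by
  ext h
  rw [Subgroup.mem_map_equiv, mem_fixingSubgroup_iff, mem_fixingSubgroup_iff]
  simp only [SetLike.mem_coe, MulAut.conj_symm_apply, mul_smul, inv_smul_eq_iff]
  constructor
  · intro H y hy
    exact H _ ((Submodule.mem_smul_pointwise_iff_exists _ g _).2 ⟨y, hy, rfl⟩)
  · intro H x hx
    obtain ⟨y, hy, rfl⟩ := (Submodule.mem_smul_pointwise_iff_exists x g _).1 hx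
    exact H y hy

/-- Conjugation by `g` identifies the Coxeter group of the full subgraph on `J` with the stabilizer
of the image under `g` of the fixed lattice of the parabolic subgroup of `J`. -/
noncomputable def stabilizerEquiv (g : weylGroup) (J : Finset (Fin 8)) :
    (coxeterMatrix (fullSubgraph J)).Group ≃* stabilizer (g • fixedLattice (parabolic J)) :=
  (coxeterEquiv J).trans <| ((MulAut.conj g).subgroupMap (parabolic J)).trans <|
    MulEquiv.subgroupCongr (by rw [stabilizer_smul, stabilizer_fixedLattice_parabolic]; rfl)

theorem stabilizerEquiv_simple (g : weylGroup) {J : Finset (Fin 8)} (j : (J : Set (Fin 8))) :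
    (stabilizerEquiv g J ((coxeterMatrix (fullSubgraph J)).simple j) : weylGroup) =
      g * simpleReflection j * g⁻¹ := by
  rw [← coxeterEquiv_simple j]
  rfl

end E8

open scoped Pointwise
theorem theorem3p6 :
    Nat.card E8.Orbits = 41 ∧
    ∃ Φ : E8.Orbits ≃ E8.SubgraphType,
      ∀ (M : E8.fixedPointSublattices) (J : Finset (Fin 8)),
        Φ (E8.orbitOf M) = Quotient.mk E8.subgraphSetoid J →
        ∃ g : E8.weylGroup,
          -- the lattice is, up to conjugation, the fixed lattice of the parabolic subgroup
          (M : Submodule ℤ E8.Lattice) = g • E8.fixedLattice (E8.parabolic J) ∧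
          -- its stabilizer is the Coxeter group determined by the subgraph
          (∃ e : (E8.coxeterMatrix (E8.fullSubgraph J)).Group ≃*
                E8.stabilizer (M : Submodule ℤ E8.Lattice),
            ∀ j, (e ((E8.coxeterMatrix (E8.fullSubgraph J)).simple j) : E8.weylGroup) =
              g * E8.simpleReflection j * g⁻¹) ∧
          -- its coinvariant lattice is the root lattice determined by the subgraph
          (∃ φ : E8.RootLattice (J : Set (Fin 8)) ≃ₗ[ℤ]
                E8.coinvariant (M : Submodule ℤ E8.Lattice),
            (∀ x y, E8.form (φ x) (φ y) =
              E8.rootLatticeForm (E8.fullSubgraph J) x y) ∧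
            ∀ j, (φ (Pi.single j 1) : E8.Lattice) = g • E8.simpleRoot j) := by
  refine ⟨(Nat.card_congr E8.subgraphTypeEquivOrbits.symm).trans E8.card_subgraphType,
    E8.subgraphTypeEquivOrbits.symm, fun M J h => ?_⟩
  rw [Equiv.symm_apply_eq] at h
  obtain ⟨g, hg⟩ := E8.orbitOf_eq_parabolicOrbit_iff.1 h
  refine ⟨g, hg, ?_⟩
  rw [hg]
  refine ⟨⟨E8.stabilizerEquiv g J, E8.stabilizerEquiv_simple g⟩,
    (E8.rootLatticeEquiv J).trans (E8.coinvariantEquiv g _), fun x y => ?_, fun j => ?_⟩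
  · rw [LinearEquiv.trans_apply, LinearEquiv.trans_apply, E8.coe_coinvariantEquiv,
      E8.coe_coinvariantEquiv, E8.form_smul_smul, E8.form_rootLatticeEquiv]
  · rw [LinearEquiv.trans_apply, E8.coe_coinvariantEquiv, E8.rootLatticeEquiv_single]
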